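/- Conventions: a representation of a $C^*$-algebra $A$ is a $*$-homomorphism $\pi : A \to \mathcal{L}(H_\pi)$ into the bounded operators on a complex Hilbert space $H_\pi$; it is irreducible if $\pi \neq 0$ and the only closed $\pi(A)$-invariant subspaces of $H_\pi$ are $0$ and $H_\pi$. A $C^*$-algebra $A$ is of Type I if for every irreducible representation $\pi$ of $A$ one has $\mathcal{K}(H_\pi) \subseteq \pi(A)$, where $\mathcal{K}(H_\pi)$ denotes the compact operators on $H_\pi$. A bounded operator on $H_\pi$ is Fredholm if its kernel is finite-dimensional and its range is closed and of finite codimension; it is invertible if it has a bounded two-sided inverse. Let $A$ be a unital $C^*$-algebra of Type I, and let $a \in A$. Then $a$ is invertible in $A$ if and only if for every irreducible representation $\pi$ of $A$ the implication $$\pi(a) \text{ is Fredholm} \;\Longrightarrow\; \pi(a) \text{ is invertible}$$ holds. -/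

import Mathlib

universe u

/-- A representation of a C⋆-algebra `A` on a complex Hilbert space `H`, i.e. a `*`-homomorphism
`π : A → 𝓛(H)`, is *irreducible* if it is non-zero and the only closed subspaces of `H`
which are invariant under `π(A)` are `0` and `H`. -/
def IsIrreducibleRep {A : Type*} [NonUnitalCStarAlgebra A]
    {H : Type*} [NormedAddCommGroup H] [InnerProductSpace ℂ H] [CompleteSpace H]
    (π : A →⋆ₙₐ[ℂ] (H →L[ℂ] H)) : Prop :=
  π ≠ 0 ∧ ∀ K : Submodule ℂ H, IsClosed (K : Set H) →
    (∀ a : A, ∀ x ∈ K, π a x ∈ K) → K = ⊥ ∨ K = ⊤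

/-- A C⋆-algebra `A` is *of Type I* if for every irreducible representation `π` of `A` on a
Hilbert space `H`, every compact operator on `H` lies in `π(A)`.

It suffices to consider Hilbert spaces in the universe of `A`: every irreducible representation
is cyclic, hence unitarily equivalent to a GNS representation built from `A`. -/
def IsTypeI (A : Type u) [NonUnitalCStarAlgebra A] : Prop :=
  ∀ (H : Type u) [NormedAddCommGroup H] [InnerProductSpace ℂ H] [CompleteSpace H]
    (π : A →⋆ₙₐ[ℂ] (H →L[ℂ] H)), IsIrreducibleRep π →
      {T : H →L[ℂ] H | IsCompactOperator T} ⊆ Set.range π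

/-! If `a` is not a unit, Zorn gives a two-sided ideal `J`, maximal among those modulo which `a` is
not invertible; ideals need not be closed. Some irreducible `π` kills `J` with `π a` not invertible:
`J + Aa` (or its analogue for `star a`) is a proper left ideal, and an extreme state vanishing on it
has an irreducible GNS representation. By Type I, `π(A)` contains a rank-one operator, so the ideal
of elements of finite rank under `π` strictly contains `J`. Maximality makes `a` invertible modulo
it, so `π a` is Fredholm by Atkinson's criterion, hence invertible by hypothesis: a contradiction.
-/

/-! ### States vanishing on a left ideal -/

/-- The norm-decreasing functionals `φ` with `φ 1 = 1` (that is, the states of `A`) which vanish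
on the left ideal `L`. -/
def statesVanishingOn {A : Type*} [CStarAlgebra A] (L : Ideal A) : Set (StrongDual ℂ A) :=
  {φ | ‖φ‖ ≤ 1 ∧ φ 1 = 1 ∧ ∀ x ∈ L, φ x = 0}

/-- A proper left ideal has distance at least one from the unit. -/
lemma Ideal.one_le_norm_one_sub {A : Type*} [NormedRing A] [CompleteSpace A] {L : Ideal A}
    (hL : L ≠ ⊤) {x : A} (hx : x ∈ L) : 1 ≤ ‖1 - x‖ := by
  by_contra! h
  refine hL (L.eq_top_of_isUnit_mem hx ?_)
  simpa using isUnit_one_sub_of_norm_lt_one h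

/-- The class of `1` in the quotient by `L` has seminorm exactly one, so Hahn–Banach provides a
norming functional there. -/
lemma statesVanishingOn_nonempty {A : Type*} [CStarAlgebra A] {L : Ideal A} (hL : L ≠ ⊤) :
    (statesVanishingOn L).Nonempty := by
  have : Nontrivial A := by
    by_contra h
    rw [not_nontrivial_iff_subsingleton] at h
    exact hL (Subsingleton.elim _ _)
  set N : Submodule ℂ A := L.restrictScalars ℂ
  have h1 : ‖(Submodule.Quotient.mk 1 : A ⧸ N)‖ = 1 := by
    refine le_antisymm ((Submodule.Quotient.norm_mk_le N 1).trans_eq norm_one) ?_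
    refine le_of_forall_pos_le_add fun ε hε => ?_
    obtain ⟨m, hm, hlt⟩ := Submodule.Quotient.norm_mk_lt (Submodule.Quotient.mk 1 : A ⧸ N) hε
    have hmem : 1 - m ∈ L := (Submodule.Quotient.eq N).1 hm.symm
    have := Ideal.one_le_norm_one_sub hL hmem
    rw [sub_sub_cancel] at this
    linarith
  obtain ⟨g, hg, hg1⟩ := exists_dual_vector ℂ (Submodule.Quotient.mk 1 : A ⧸ N) (by simp [h1])
  refine ⟨g ∘L N.mkQL, ?_, ?_, fun x hx => ?_⟩
  · refine ContinuousLinearMap.opNorm_le_bound _ zero_le_one fun x => ?_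
    calc ‖g (Submodule.Quotient.mk x)‖ ≤ ‖g‖ * ‖(Submodule.Quotient.mk x : A ⧸ N)‖ := g.le_opNorm _
      _ ≤ 1 * ‖x‖ := by
        rw [hg]; gcongr; exact Submodule.Quotient.norm_mk_le N x
  · simpa [h1] using hg1
  · have : (Submodule.Quotient.mk x : A ⧸ N) = 0 := (Submodule.Quotient.mk_eq_zero N).2 hx
    simp [this]

/-- By the Krein–Milman lemma, the set of states vanishing on a proper left ideal has an extreme
point. -/
lemma exists_mem_extremePoints_statesVanishingOn {A : Type*} [CStarAlgebra A] {L : Ideal A}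
    (hL : L ≠ ⊤) : ∃ φ, φ ∈ (statesVanishingOn L).extremePoints ℝ := by
  set S : Set (WeakDual ℂ A) := WeakDual.toStrongDual ⁻¹' statesVanishingOn L
  have hS : S = WeakDual.toStrongDual ⁻¹' Metric.closedBall 0 1 ∩
      ({φ | φ 1 = 1} ∩ ⋂ x ∈ L, {φ | φ x = 0}) := by
    ext φ
    simp [S, statesVanishingOn]
  have hc : IsCompact S := by
    rw [hS]
    refine (WeakDual.isCompact_closedBall 0 1).inter_right (IsClosed.inter ?_ ?_)
    · exact isClosed_eq (WeakDual.eval_continuous 1) continuous_const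
    · exact isClosed_biInter fun x _ => isClosed_eq (WeakDual.eval_continuous x) continuous_const
  have : LocallyConvexSpace ℝ (WeakDual ℂ A) :=
    WeakBilin.locallyConvexSpace (B := topDualPairing ℂ A)
  obtain ⟨φ, hφ⟩ := hc.extremePoints_nonempty (statesVanishingOn_nonempty hL)
  exact ⟨WeakDual.toStrongDual φ, hφ⟩

open scoped ComplexOrder InnerProductSpace

lemma im_apply_eq_zero_of_isSelfAdjoint {A : Type*} [CStarAlgebra A] {φ : StrongDual ℂ A}
    (hφ : ‖φ‖ ≤ 1) (h1 : φ 1 = 1) {x : A} (hx : IsSelfAdjoint x) : (φ x).im = 0 := by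
  have key (t : ℝ) : ((φ x).im + t) ^ 2 ≤ ‖x‖ ^ 2 + t ^ 2 := by
    set y : A := x + (t * Complex.I : ℂ) • 1
    have hy : star y * y = x * x + ((t : ℂ) ^ 2) • 1 := by
      simp only [y, star_add, hx.star_eq, star_smul, star_one, add_mul, mul_add, smul_mul_assoc,
        mul_smul_comm, one_mul, mul_one, smul_add, smul_smul]
      have h2 : (t * Complex.I : ℂ) * star (t * Complex.I : ℂ) = (t : ℂ) ^ 2 := by
        simp; ring_nf; simp
      have h3 : star (t * Complex.I : ℂ) = -(t * Complex.I : ℂ) := by simp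
      rw [h2, h3]
      module
    have hn : ‖(1 : A)‖ ≤ 1 := by
      rcases subsingleton_or_nontrivial A with h | h
      · simp [Subsingleton.elim (1 : A) 0]
      · simp
    have hle : ‖φ y‖ ≤ ‖y‖ := by simpa using φ.le_of_opNorm_le hφ y
    have him : (φ x).im + t = (φ y).im := by simp [y, h1]
    calc ((φ x).im + t) ^ 2 ≤ ‖φ y‖ ^ 2 := by
          rw [him, sq_le_sq, abs_norm]; exact Complex.abs_im_le_norm _
      _ ≤ ‖y‖ ^ 2 := by gcongr
      _ = ‖x * x + ((t : ℂ) ^ 2) • 1‖ := by rw [← hy, CStarRing.norm_star_mul_self, sq]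
      _ ≤ ‖x‖ * ‖x‖ + t ^ 2 * 1 := by
          refine (norm_add_le _ _).trans (add_le_add (norm_mul_le x x) ?_)
          rw [norm_smul]
          simp only [norm_pow, Complex.norm_real, Real.norm_eq_abs, sq_abs]
          gcongr
      _ = ‖x‖ ^ 2 + t ^ 2 := by ring
  by_contra h
  -- This `t` makes the cross term `2 * (φ x).im * t` equal to `2 * (‖x‖ ^ 2 + 1)`, too large for
  -- `key`.
  have h2 := key ((‖x‖ ^ 2 + 1) / (φ x).im)
  have h3 : (φ x).im * ((‖x‖ ^ 2 + 1) / (φ x).im) = ‖x‖ ^ 2 + 1 := by field_simp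
  nlinarith [sq_nonneg (φ x).im, sq_nonneg ‖x‖]

/-- A norm-decreasing functional with `φ 1 = 1` is positive. -/
lemma apply_nonneg_of_norm_le_one {A : Type*} [CStarAlgebra A] [PartialOrder A] [StarOrderedRing A]
    {φ : StrongDual ℂ A} (hφ : ‖φ‖ ≤ 1) (h1 : φ 1 = 1) {x : A} (hx : 0 ≤ x) : 0 ≤ φ x := by
  have hsa : IsSelfAdjoint x := .of_nonneg hx
  have : Nontrivial A := by
    refine ⟨⟨1, 0, fun h => ?_⟩⟩
    simp [h] at h1
  refine Complex.nonneg_iff.2 ⟨?_, (im_apply_eq_zero_of_isSelfAdjoint hφ h1 hsa).symm⟩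
  set y : A := algebraMap ℝ A ‖x‖ - x
  have hy : ‖y‖ ≤ ‖x‖ := by
    have := CStarAlgebra.norm_le_norm_of_nonneg_of_le
      (sub_nonneg.2 (IsSelfAdjoint.le_algebraMap_norm_self hsa)) (sub_le_self _ hx)
    simpa using this
  have hle : ‖φ y‖ ≤ ‖x‖ := (by simpa using φ.le_of_opNorm_le hφ y : ‖φ y‖ ≤ ‖y‖).trans hy
  have hφy : φ y = (‖x‖ : ℂ) - φ x := by
    have : algebraMap ℝ A ‖x‖ = (‖x‖ : ℂ) • 1 := by
      rw [Algebra.algebraMap_eq_smul_one, Complex.coe_smul]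
    simp [y, this, h1]
  have := (Complex.re_le_norm _).trans hle
  simp [hφy] at this
  exact this

/-! ### Irreducible representations from extreme states -/

/-- Every state is a vector state of a representation in which the vector is cyclic (the
Gelfand–Naimark–Segal construction). -/
lemma exists_cyclic_rep_of_state {A : Type u} [CStarAlgebra A] {φ : StrongDual ℂ A}
    (hφ : ‖φ‖ ≤ 1) (h1 : φ 1 = 1) :
    ∃ (H : Type u) (_ : NormedAddCommGroup H) (_ : InnerProductSpace ℂ H) (_ : CompleteSpace H)
      (π : A →⋆ₙₐ[ℂ] (H →L[ℂ] H)) (ξ : H), DenseRange (fun a => π a ξ) ∧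
      π 1 ξ = ξ ∧ ∀ a, ⟪ξ, π a ξ⟫_ℂ = φ a := by
  let _ := CStarAlgebra.spectralOrder A
  have _ := CStarAlgebra.spectralOrderedRing A
  let f : A →ₚ[ℂ] ℂ := PositiveLinearMap.mk₀ φ.toLinearMap
    fun x hx => apply_nonneg_of_norm_le_one hφ h1 hx
  have hπ (a : A) : f.gnsNonUnitalStarAlgHom a ((f.toPreGNS 1 : f.PreGNS) : f.GNS) =
      ((f.toPreGNS a : f.PreGNS) : f.GNS) := by
    simp
  refine ⟨f.GNS, inferInstance, inferInstance, inferInstance, f.gnsNonUnitalStarAlgHom,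
    ((f.toPreGNS 1 : f.PreGNS) : f.GNS), ?_, hπ 1, fun a => ?_⟩
  · simp only [hπ]
    exact UniformSpace.Completion.denseRange_coe.comp f.toPreGNS.surjective.denseRange
      (UniformSpace.Completion.continuous_coe _)
  · rw [hπ, UniformSpace.Completion.inner_coe, PositiveLinearMap.preGNS_inner_def]
    simp only [PositiveLinearMap.ofPreGNS_toPreGNS, star_one, one_mul]
    rfl

/-- The functional `a ↦ ⟪p, π a p⟫ / ‖p‖²` is a state. -/
lemma exists_mem_statesVanishingOn_of_vector {A : Type*} [CStarAlgebra A] {H : Type*}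
    [NormedAddCommGroup H] [InnerProductSpace ℂ H] [CompleteSpace H] (π : A →⋆ₙₐ[ℂ] (H →L[ℂ] H))
    {L : Ideal A} {p : H} (hp : p ≠ 0) (h1 : π 1 p = p) (hL : ∀ x ∈ L, π x p = 0) :
    ∃ ψ ∈ statesVanishingOn L, ∀ a, ψ a = ((‖p‖ ^ 2)⁻¹ : ℝ) * ⟪p, π a p⟫_ℂ := by
  have hp' : ‖p‖ ≠ 0 := norm_ne_zero_iff.2 hp
  let l : A →ₗ[ℂ] ℂ :=
    { toFun := fun a => ((‖p‖ ^ 2)⁻¹ : ℝ) * ⟪p, π a p⟫_ℂ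
      map_add' := fun a b => by simp [mul_add]
      map_smul' := fun c a => by simp; ring }
  have hl (a : A) : ‖l a‖ ≤ 1 * ‖a‖ := by
    have h : ‖⟪p, π a p⟫_ℂ‖ ≤ ‖p‖ * (‖a‖ * ‖p‖) := by
      refine (norm_inner_le_norm _ _).trans ?_
      gcongr
      exact (π a).le_of_opNorm_le (NonUnitalStarAlgHom.norm_apply_le π a) p
    calc ‖l a‖ = (‖p‖ ^ 2)⁻¹ * ‖⟪p, π a p⟫_ℂ‖ := by simp [l]
      _ ≤ (‖p‖ ^ 2)⁻¹ * (‖p‖ * (‖a‖ * ‖p‖)) := by gcongr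
      _ = 1 * ‖a‖ := by field_simp
  refine ⟨l.mkContinuous 1 hl, ⟨l.mkContinuous_norm_le zero_le_one hl, ?_, fun x hx => ?_⟩,
    fun a => rfl⟩
  · simp only [LinearMap.mkContinuous_apply, l, LinearMap.coe_mk, AddHom.coe_mk, h1,
      inner_self_eq_norm_sq_to_K]
    push_cast
    have : (‖p‖ : ℂ) ≠ 0 := by exact_mod_cast hp'
    simp [this]
  · simp [l, hL x hx]

/-- The cyclic representation of an extreme point of the set of states vanishing on a left ideal
is irreducible. -/
lemma isIrreducibleRep_of_mem_extremePoints {A : Type*} [CStarAlgebra A] {H : Type*}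
    [NormedAddCommGroup H] [InnerProductSpace ℂ H] [CompleteSpace H] (π : A →⋆ₙₐ[ℂ] (H →L[ℂ] H))
    {ξ : H} (hξ : DenseRange fun a => π a ξ) (h1 : π 1 ξ = ξ) {L : Ideal A}
    (hL : ∀ x ∈ L, π x ξ = 0) {φ : StrongDual ℂ A} (hφ : ∀ a, ⟪ξ, π a ξ⟫_ℂ = φ a)
    (hext : φ ∈ (statesVanishingOn L).extremePoints ℝ) : IsIrreducibleRep π := by
  obtain ⟨⟨-, hφ1, -⟩, hext⟩ := hext
  have hnorm : ‖ξ‖ ^ 2 = 1 := by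
    have h := hφ 1
    rw [h1, hφ1, inner_self_eq_norm_sq_to_K] at h
    refine Complex.ofReal_injective ?_
    simpa using h
  refine ⟨fun h => by simp [h] at h1; simp [← h1] at hnorm, fun K hK hinv => ?_⟩
  have : K.HasOrthogonalProjection := by
    have := hK.completeSpace_coe
    infer_instance
  have hinv' (a : A) (x : H) (hx : x ∈ Kᗮ) : π a x ∈ Kᗮ := by
    rw [Submodule.mem_orthogonal] at hx ⊢
    intro u hu
    rw [← ContinuousLinearMap.adjoint_inner_left, ← ContinuousLinearMap.star_eq_adjoint,
      ← map_star]
    exact hx _ (hinv _ u hu)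
  obtain ⟨p, hp, q, hq, hpq⟩ := K.exists_add_mem_mem_orthogonal ξ
  have horth {u v : H} (hu : u ∈ K) (hv : v ∈ Kᗮ) : ⟪u, v⟫_ℂ = 0 :=
    Submodule.inner_right_of_mem_orthogonal hu hv
  have horth' {u v : H} (hu : u ∈ K) (hv : v ∈ Kᗮ) : ⟪v, u⟫_ℂ = 0 :=
    Submodule.inner_left_of_mem_orthogonal hu hv
  by_cases hp0 : p = 0
  · left
    have hξq : ξ = q := by simpa [hp0] using hpq
    rw [Submodule.eq_bot_iff]
    intro x hx
    refine hξ.eq_zero_of_inner_left ℂ fun a => ?_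
    rw [hξq]
    exact horth hx (hinv' a q hq)
  by_cases hq0 : q = 0
  · right
    have hξp : ξ = p := by simpa [hq0] using hpq
    have : (K : Set H) = Set.univ := by
      rw [← hK.closure_eq, ← Set.univ_subset_iff, ← hξ.closure_range]
      refine closure_mono ?_
      rintro _ ⟨a, rfl⟩
      simpa [hξp] using hinv a p hp
    exact SetLike.coe_injective (by simpa using this)
  exfalso
  have hsplit (a : A) : π a p + π a q = π a ξ := by rw [hpq, map_add]
  have hp1 : π 1 p = p ∧ π 1 q = q := by
    have h := hsplit 1
    rw [h1, hpq] at h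
    have h2 : π 1 p - p = q - π 1 q := by rw [sub_eq_sub_iff_add_eq_add, h, add_comm]
    -- The vector lies in both `K` and `Kᗮ`.
    have h3 : π 1 p - p = 0 := by
      have hm1 : π 1 p - p ∈ K := K.sub_mem (hinv 1 p hp) hp
      have hm2 : π 1 p - p ∈ Kᗮ := h2 ▸ Kᗮ.sub_mem hq (hinv' 1 q hq)
      exact inner_self_eq_zero.1 (horth hm1 hm2)
    exact ⟨sub_eq_zero.1 h3, (sub_eq_zero.1 (h2 ▸ h3)).symm⟩
  have hL' (x : A) (hx : x ∈ L) : π x p = 0 ∧ π x q = 0 := by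
    have h := hsplit x
    rw [hL x hx] at h
    have h3 : π x p = 0 := by
      have hm2 : π x p ∈ Kᗮ := by
        rw [eq_neg_of_add_eq_zero_left h]; exact Kᗮ.neg_mem (hinv' x q hq)
      exact inner_self_eq_zero.1 (horth (hinv x p hp) hm2)
    exact ⟨h3, by simpa [h3] using h⟩
  obtain ⟨ψ, hψ, hψp⟩ := exists_mem_statesVanishingOn_of_vector π hp0 hp1.1 fun x hx => (hL' x hx).1
  obtain ⟨χ, hχ, hχq⟩ := exists_mem_statesVanishingOn_of_vector π hq0 hp1.2 fun x hx => (hL' x hx).2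
  have hpyth : ‖p‖ ^ 2 + ‖q‖ ^ 2 = 1 := by
    rw [← hnorm, hpq, sq, sq, sq, norm_add_sq_eq_norm_sq_add_norm_sq_of_inner_eq_zero p q
      (horth hp hq)]
  have hp' : (‖p‖ : ℂ) ≠ 0 := by simpa using hp0
  have hq' : (‖q‖ : ℂ) ≠ 0 := by simpa using hq0
  -- `φ` is the convex combination of the vector states of `p` and `q` with weights `‖p‖ ^ 2` and
  -- `‖q‖ ^ 2`.
  have hψφ : ψ = φ := by
    refine hext hψ hχ ⟨‖p‖ ^ 2, ‖q‖ ^ 2, by positivity, by positivity, hpyth, ?_⟩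
    ext a
    simp only [add_apply, smul_apply, hψp, hχq,
      Complex.real_smul]
    rw [← hφ, ← hsplit, hpq, inner_add_left, inner_add_right, inner_add_right,
      horth hp (hinv' a q hq), horth' (hinv a p hp) hq]
    push_cast
    field_simp
    ring
  -- Equality of the states makes `p` a multiple of `ξ` by cyclicity; pairing with `q` then
  -- contradicts `q ≠ 0`.
  have hpξ : p - ((‖p‖ ^ 2 : ℝ) : ℂ) • ξ = 0 := by
    refine hξ.eq_zero_of_inner_left ℂ fun a => ?_
    rw [inner_sub_left, inner_smul_left, hφ, ← hψφ, hψp, ← hsplit, inner_add_right,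
      horth hp (hinv' a q hq), Complex.conj_ofReal]
    push_cast
    field_simp
    ring
  have hz : ⟪q, p - ((‖p‖ ^ 2 : ℝ) : ℂ) • ξ⟫_ℂ = 0 := by rw [hpξ, inner_zero_right]
  rw [hpq, inner_sub_right, inner_smul_right, inner_add_right, horth' hp hq,
    inner_self_eq_norm_sq_to_K] at hz
  simp [hp', hq'] at hz

/-- Every proper left ideal annihilates a cyclic vector of some irreducible representation. -/
lemma exists_irreducibleRep_of_ne_top {A : Type u} [CStarAlgebra A] {L : Ideal A} (hL : L ≠ ⊤) :
    ∃ (H : Type u) (_ : NormedAddCommGroup H) (_ : InnerProductSpace ℂ H) (_ : CompleteSpace H)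
      (π : A →⋆ₙₐ[ℂ] (H →L[ℂ] H)) (ξ : H), IsIrreducibleRep π ∧ DenseRange (fun a => π a ξ) ∧
      ξ ≠ 0 ∧ ∀ x ∈ L, π x ξ = 0 := by
  obtain ⟨φ, hφ⟩ := exists_mem_extremePoints_statesVanishingOn hL
  obtain ⟨hn, h1, hφL⟩ := hφ.1
  obtain ⟨H, _, _, _, π, ξ, hξ, hξ1, hπ⟩ := exists_cyclic_rep_of_state hn h1
  have hπL (x : A) (hx : x ∈ L) : π x ξ = 0 := by
    have h := hπ (star x * x)
    rw [hφL _ (L.mul_mem_left _ hx), map_mul, map_star, mul_apply_eq_comp,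
      ContinuousLinearMap.star_eq_adjoint, ContinuousLinearMap.adjoint_inner_right] at h
    exact inner_self_eq_zero.1 h
  refine ⟨H, _, _, _, π, ξ, isIrreducibleRep_of_mem_extremePoints π hξ hξ1 hπL hπ hφ, hξ, ?_, hπL⟩
  rintro rfl
  have h := hπ 1
  rw [inner_zero_left, h1] at h
  exact zero_ne_one h

/-! ### Invertibility modulo a two-sided ideal -/

/-- `a` is invertible modulo the ideal `J`. -/
def IsInvertibleMod {A : Type*} [Ring A] (J : Ideal A) (a : A) : Prop :=
  ∃ b, a * b - 1 ∈ J ∧ b * a - 1 ∈ J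

lemma IsInvertibleMod.of_left_of_right {A : Type*} [Ring A] {J : Ideal A} [J.IsTwoSided] {a b c : A}
    (hb : b * a - 1 ∈ J) (hc : a * c - 1 ∈ J) : IsInvertibleMod J a := by
  refine ⟨b, ?_, hb⟩
  have h1 : b * (a * c - 1) ∈ J := J.mul_mem_left _ hc
  have h2 : (b * a - 1) * c ∈ J := J.mul_mem_right _ hb
  have h3 : a * ((b * a - 1) * c - b * (a * c - 1)) ∈ J := J.mul_mem_left _ (J.sub_mem h2 h1)
  have h4 : a * b - 1 = (a * c - 1) + a * ((b * a - 1) * c - b * (a * c - 1)) := by noncomm_ring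
  exact h4 ▸ J.add_mem hc h3

/-- If `a` is not left invertible modulo `J`, some irreducible representation killing `J` sends
`a` to an operator with a kernel. -/
lemma exists_irreducibleRep_of_forall_mul_sub_one_notMem {A : Type u} [CStarAlgebra A] {J : Ideal A}
    [J.IsTwoSided] {a : A} (ha : ∀ b, b * a - 1 ∉ J) :
    ∃ (H : Type u) (_ : NormedAddCommGroup H) (_ : InnerProductSpace ℂ H) (_ : CompleteSpace H)
      (π : A →⋆ₙₐ[ℂ] (H →L[ℂ] H)), IsIrreducibleRep π ∧ (∀ x ∈ J, π x = 0) ∧ ¬ IsUnit (π a) := by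
  have hL : J ⊔ Ideal.span {a} ≠ ⊤ := by
    intro h
    obtain ⟨j, hj, y, hy, hjy⟩ := Submodule.mem_sup.1 (h ▸ Submodule.mem_top : (1 : A) ∈ _)
    obtain ⟨b, rfl⟩ := Ideal.mem_span_singleton'.1 hy
    refine ha b ?_
    rw [← hjy, sub_add_cancel_right]
    exact J.neg_mem hj
  obtain ⟨H, _, _, _, π, ξ, hπ, hξ, hξ0, hπL⟩ := exists_irreducibleRep_of_ne_top hL
  refine ⟨H, _, _, _, π, hπ, fun x hx => ?_, fun hu => hξ0 ?_⟩
  · refine DFunLike.coe_injective (hξ.equalizer (π x).continuous continuous_const ?_)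
    funext c
    have := hπL (x * c) (Ideal.mem_sup_left (J.mul_mem_right c hx))
    simpa using this
  · obtain ⟨v, hv⟩ := hu.exists_left_inv
    have h := hπL a (Ideal.mem_sup_right (Ideal.mem_span_singleton_self a))
    calc ξ = (v * π a) ξ := by simp [hv]
      _ = 0 := by simp [h]

/-- The image of a two-sided ideal under the involution. -/
def Ideal.starTwoSided {A : Type*} [Ring A] [StarRing A] (J : Ideal A) [J.IsTwoSided] :
    Ideal A where
  carrier := {x | star x ∈ J}
  add_mem' {x y} hx hy := by simpa using J.add_mem hx hy
  zero_mem' := by simp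
  smul_mem' c x hx := by simpa using J.mul_mem_right (star c) hx

instance {A : Type*} [Ring A] [StarRing A] (J : Ideal A) [J.IsTwoSided] :
    J.starTwoSided.IsTwoSided where
  mul_mem_of_left {x} b hx := by
    change star (x * b) ∈ J
    rw [star_mul]
    exact J.mul_mem_left _ hx

/-- If `a` is left invertible modulo `J`, it is not right invertible, so `star a` is not left
invertible modulo the adjoint ideal. -/
lemma exists_irreducibleRep_of_not_isInvertibleMod {A : Type u} [CStarAlgebra A] {J : Ideal A}
    [J.IsTwoSided] {a : A} (ha : ¬ IsInvertibleMod J a) :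
    ∃ (H : Type u) (_ : NormedAddCommGroup H) (_ : InnerProductSpace ℂ H) (_ : CompleteSpace H)
      (π : A →⋆ₙₐ[ℂ] (H →L[ℂ] H)), IsIrreducibleRep π ∧ (∀ x ∈ J, π x = 0) ∧ ¬ IsUnit (π a) := by
  by_cases hl : ∀ b, b * a - 1 ∉ J
  · exact exists_irreducibleRep_of_forall_mul_sub_one_notMem hl
  push Not at hl
  obtain ⟨b, hb⟩ := hl
  have hr (c : A) : c * star a - 1 ∉ J.starTwoSided := by
    intro hc
    have hc' : star (c * star a - 1) ∈ J := hc
    exact ha (.of_left_of_right hb (c := star c) (by simpa using hc'))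
  obtain ⟨H, _, _, _, π, hπ, hJ, hu⟩ := exists_irreducibleRep_of_forall_mul_sub_one_notMem hr
  refine ⟨H, _, _, _, π, hπ, fun x hx => ?_, fun h => hu ?_⟩
  · have := hJ (star x) (by change star (star x) ∈ J; rwa [star_star])
    rwa [map_star, star_eq_zero] at this
  · rw [map_star]
    exact h.star

/-- There is a largest two-sided ideal modulo which a given non-unit is not invertible. -/
lemma exists_maximal_not_isInvertibleMod {A : Type*} [Ring A] {a : A} (ha : ¬ IsUnit a) :
    ∃ J : Ideal A, Maximal (fun J : Ideal A => J.IsTwoSided ∧ ¬ IsInvertibleMod J a) J := by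
  suffices h : ∃ J : Ideal A, ⊥ ≤ J ∧ Maximal (· ∈ {J : Ideal A | J.IsTwoSided ∧
      ¬ IsInvertibleMod J a}) J from h.imp fun J hJ => hJ.2
  refine zorn_le_nonempty₀ _ (fun c hc hchain y hy => ?_) ⊥ ⟨inferInstance, ?_⟩
  · have hmem {x : A} : x ∈ sSup c ↔ ∃ J ∈ c, x ∈ J :=
      Submodule.mem_sSup_of_directed ⟨y, hy⟩ hchain.directedOn
    refine ⟨sSup c, ⟨⟨fun {x} b hx => ?_⟩, ?_⟩, fun z hz => le_sSup hz⟩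
    · obtain ⟨J, hJ, hxJ⟩ := hmem.1 hx
      have := (hc hJ).1
      exact hmem.2 ⟨J, hJ, J.mul_mem_right b hxJ⟩
    -- Invertibility involves only two memberships, so it already holds modulo one member of the
    -- chain.
    · rintro ⟨b, h1, h2⟩
      obtain ⟨J, hJ, h1⟩ := hmem.1 h1
      obtain ⟨K, hK, h2⟩ := hmem.1 h2
      obtain ⟨M, hM, hJM, hKM⟩ := hchain.directedOn J hJ K hK
      exact (hc hM).2 ⟨b, hJM h1, hKM h2⟩
  · rintro ⟨b, h1, h2⟩
    rw [Ideal.mem_bot, sub_eq_zero] at h1 h2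
    exact ha ⟨⟨a, b, h1, h2⟩, rfl⟩

/-! ### Finite rank operators and the Fredholm property -/

/-- An irreducible representation of a unital algebra is unital. -/
lemma IsIrreducibleRep.map_one {A : Type*} [CStarAlgebra A] {H : Type*}
    [NormedAddCommGroup H] [InnerProductSpace ℂ H] [CompleteSpace H] {π : A →⋆ₙₐ[ℂ] (H →L[ℂ] H)}
    (hπ : IsIrreducibleRep π) : π 1 = 1 := by
  have key (a : A) (x : H) : π 1 (π a x) = π a x := by
    rw [← mul_apply_eq_comp, ← map_mul, one_mul]
  rcases hπ.2 ((π 1).toLinearMap.eqLocus LinearMap.id)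
    (isClosed_eq (π 1).continuous continuous_id) (fun a x _ => key a x) with h | h
  · refine absurd ?_ hπ.1
    ext a x
    have : π a x ∈ (π 1).toLinearMap.eqLocus LinearMap.id := key a x
    rw [h] at this
    simpa using this
  · ext x
    exact (h ▸ Submodule.mem_top : x ∈ (π 1).toLinearMap.eqLocus LinearMap.id)

/-- The elements of `A` which a representation sends to operators of finite rank. -/
def finiteRankIdeal {A : Type*} [CStarAlgebra A] {H : Type*}
    [NormedAddCommGroup H] [InnerProductSpace ℂ H] [CompleteSpace H] (π : A →⋆ₙₐ[ℂ] (H →L[ℂ] H)) :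
    Ideal A where
  carrier := {x | (π x).toLinearMap.HasNoetherianRange}
  add_mem' {x y} hx hy := by
    have := LinearMap.HasNoetherianRange.add hx hy
    simpa using this
  zero_mem' := by simp
  smul_mem' c x hx := by
    have := LinearMap.HasNoetherianRange.comp_left hx (π c).toLinearMap
    rw [Set.mem_ofPred_eq, smul_eq_mul, map_mul]
    exact this

instance {A : Type*} [CStarAlgebra A] {H : Type*}
    [NormedAddCommGroup H] [InnerProductSpace ℂ H] [CompleteSpace H] (π : A →⋆ₙₐ[ℂ] (H →L[ℂ] H)) :
    (finiteRankIdeal π).IsTwoSided where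
  mul_mem_of_left {x} c hx := by
    have := LinearMap.HasNoetherianRange.comp_right hx (π c).toLinearMap
    change (π (x * c)).toLinearMap.HasNoetherianRange
    rw [map_mul]
    exact this

/-- An element which is invertible modulo finite rank operators is sent to a Fredholm operator. -/
lemma isFredholm_of_isInvertibleMod_finiteRankIdeal {A : Type*} [CStarAlgebra A] {H : Type*}
    [NormedAddCommGroup H] [InnerProductSpace ℂ H] [CompleteSpace H] {π : A →⋆ₙₐ[ℂ] (H →L[ℂ] H)}
    (h1 : π 1 = 1) {a : A} (ha : IsInvertibleMod (finiteRankIdeal π) a) : (π a).IsFredholm := by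
  obtain ⟨b, hab, hba⟩ := ha
  refine .of_isQuasiInverse (v := π b) ⟨?_, ?_⟩
  · refine LinearMap.FiniteRangeSetoid.equiv_iff_hasNoetherianRange.2 ?_
    change (π (b * a - 1)).toLinearMap.HasNoetherianRange at hba
    rwa [map_sub, map_mul, h1] at hba
  · refine LinearMap.FiniteRangeSetoid.equiv_iff_hasNoetherianRange.2 ?_
    change (π (a * b - 1)).toLinearMap.HasNoetherianRange at hab
    rwa [map_sub, map_mul, h1] at hab

lemma IsTypeI.exists_mem_finiteRankIdeal {A : Type u} [CStarAlgebra A] (hA : IsTypeI A)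
    {H : Type u} [NormedAddCommGroup H] [InnerProductSpace ℂ H] [CompleteSpace H]
    {π : A →⋆ₙₐ[ℂ] (H →L[ℂ] H)} (hπ : IsIrreducibleRep π) : ∃ x ∈ finiteRankIdeal π, π x ≠ 0 := by
  have : Nontrivial H := by
    by_contra h
    rw [not_nontrivial_iff_subsingleton] at h
    exact hπ.1 (by ext a x; exact Subsingleton.elim _ _)
  obtain ⟨v, hv⟩ := exists_ne (0 : H)
  set T : H →L[ℂ] H := InnerProductSpace.rankOne ℂ v v
  have hT : IsCompactOperator T :=
    (isCompactOperator_of_locallyCompactSpace_dom (innerSL ℂ v)).clm_comp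
      (ContinuousLinearMap.toSpanSingleton ℂ v)
  obtain ⟨x, hx⟩ := hA H π hπ hT
  refine ⟨x, ?_, ?_⟩
  · change (π x).toLinearMap.HasNoetherianRange
    rw [hx]
    exact LinearMap.HasNoetherianRange.comp_left
      (.of_isNoetherian_rng (f := (innerSL ℂ v).toLinearMap))
      (ContinuousLinearMap.toSpanSingleton ℂ v).toLinearMap
  · rw [hx]
    simp [T, hv]

theorem mainTheorem3 (A : Type u) [CStarAlgebra A] (hA : IsTypeI A) (a : A) :
    IsUnit a ↔
      ∀ (H : Type u) [NormedAddCommGroup H] [InnerProductSpace ℂ H] [CompleteSpace H]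
        (π : A →⋆ₙₐ[ℂ] (H →L[ℂ] H)), IsIrreducibleRep π →
          (π a).IsFredholm → IsUnit (π a) := by
  refine ⟨fun ha H _ _ _ π hπ _ => ?_, fun h => ?_⟩
  · obtain ⟨u, rfl⟩ := ha
    refine ⟨⟨π u, π ↑u⁻¹, ?_, ?_⟩, rfl⟩
    · rw [← map_mul, Units.mul_inv, hπ.map_one]
    · rw [← map_mul, Units.inv_mul, hπ.map_one]
  · by_contra ha
    obtain ⟨J, hJ⟩ := exists_maximal_not_isInvertibleMod ha
    have := hJ.prop.1
    obtain ⟨H, _, _, _, π, hπ, hJπ, hu⟩ := exists_irreducibleRep_of_not_isInvertibleMod hJ.prop.2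
    obtain ⟨x, hx, hx0⟩ := hA.exists_mem_finiteRankIdeal hπ
    refine hu (h H π hπ (isFredholm_of_isInvertibleMod_finiteRankIdeal hπ.map_one ?_))
    by_contra hF
    have hle : J ≤ finiteRankIdeal π := fun y hy => by
      change (π y).toLinearMap.HasNoetherianRange
      simp [hJπ y hy]
    -- Maximality forces the finite rank ideal into `J`, which `π` kills, although `π x ≠ 0`.
    exact hx0 (hJπ x (hJ.le_of_ge ⟨inferInstance, hF⟩ hle hx))
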